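/- Let $\varphi_\sigma(x)=(2\pi\sigma^2)^{-d/2}\exp(-\|x\|_2^2/(2\sigma^2))$ be the density of $\mathcal N(0,\sigma^2 I_d)$. A probability distribution $P$ on $\mathbb R^d$ is called $\alpha$-sub-Gaussian, $0<\alpha<\infty$, if $\mathbb E_{X\sim P}[\exp(\theta^\top(X-\mathbb E X))]\le\exp(\alpha^2\|\theta\|_2^2/2)$ for all $\theta\in\mathbb R^d$. For a sample $x^{(1)},\dots,x^{(n)}$ drawn i.i.d. from $P$, let $\hat P^{(n)}=\frac1n\sum_{i=1}^n\delta_{x^{(i)}}$, and let $p_\sigma(x)=\int\varphi_\sigma(x-y)\,dP(y)$ and $\hat p_\sigma(x)=\frac1n\sum_{i=1}^n\varphi_\sigma(x-x^{(i)})$ be the densities of $P*\mathcal N(0,\sigma^2I_d)$ and $\hat P^{(n)}*\mathcal N(0,\sigma^2I_d)$. Write $a\vee b=\max\{a,b\}$. For every $d\ge1$ and every $c>0$ there is a constant $C>0$, depending only on $d$ and $c$, such that for every $n\ge3$, every $\alpha>0$, every $\alpha$-sub-Gaussian distribution $P$ on $\mathbb R^d$, every $\sigma\ge c\,\alpha\,n^{-1/d}\log^{1/2}n$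 and every $\rho_n$ with $0<\rho_n\le(2\pi\sigma^2)^{-d/2}e^{-1}n^{-1}$, $$\mathbb E_{\{x^{(i)}\}\sim P^{\otimes n}}\Bigl[\int_{\mathbb R^d}\Bigl\|\frac{\nabla p_\sigma(x)}{p_\sigma(x)}-\frac{\nabla\hat p_\sigma(x)}{\hat p_\sigma(x)\vee\rho_n}\Bigr\|_2^2\,p_\sigma(x)\,dx\Bigr]\le C\,\sigma^{-d-2}\bigl(\sigma^d+\alpha^d\bigr)\log^3\Bigl(\frac{(2\pi\sigma^2)^{-d/2}}{\rho_n}\Bigr)\frac{\log^{d/2}n}{n}.$$ -/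

import Mathlib

open MeasureTheory
open scoped ENNReal RealInnerProductSpace

noncomputable section

namespace SubGaussianScore

/-- A probability distribution `P` on `ℝ^d` is `α`-sub-Gaussian (`0 < α < ∞`) if it has a mean and
`E exp ⟨θ, X - E X⟩ ≤ exp (α² ‖θ‖² / 2)` (in particular the left side is finite) for all `θ`. -/
structure IsSubGaussian {d : ℕ} (P : Measure (EuclideanSpace ℝ (Fin d))) (α : ℝ) : Prop where
  pos : 0 < α
  integrable_id : Integrable (fun x => x) P
  integrable_exp : ∀ θ : EuclideanSpace ℝ (Fin d),
    Integrable (fun x => Real.exp ⟪θ, x - ∫ y, y ∂P⟫) P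
  mgf_le : ∀ θ : EuclideanSpace ℝ (Fin d),
    ∫ x, Real.exp ⟪θ, x - ∫ y, y ∂P⟫ ∂P ≤ Real.exp (α ^ 2 * ‖θ‖ ^ 2 / 2)

/-- The density `φ_σ` of the Gaussian distribution `N(0, σ² I_d)`. -/
def gaussianDensity {d : ℕ} (σ : ℝ) (x : EuclideanSpace ℝ (Fin d)) : ℝ :=
  (2 * Real.pi * σ ^ 2) ^ (-(d : ℝ) / 2) * Real.exp (-‖x‖ ^ 2 / (2 * σ ^ 2))

/-- The Gaussian distribution `N(0, σ² I_d)`. -/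
def gaussianMeasure (d : ℕ) (σ : ℝ) : Measure (EuclideanSpace ℝ (Fin d)) :=
  ProbabilityTheory.multivariateGaussian 0 (σ ^ 2 • (1 : Matrix (Fin d) (Fin d) ℝ))

/-- The (smooth) density `p_σ(x) = ∫ φ_σ(x - y) dP(y)` of the smoothed distribution
`P_σ = P * N(0, σ² I_d)`; see `conv_gaussianMeasure_eq_withDensity`. -/
def smoothedDensity {d : ℕ} (P : Measure (EuclideanSpace ℝ (Fin d))) (σ : ℝ)
    (x : EuclideanSpace ℝ (Fin d)) : ℝ :=
  ∫ y, gaussianDensity σ (x - y) ∂P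

/-- The empirical distribution `n⁻¹ ∑ i, δ_{x i}` of a sample `x 0, …, x (n - 1)`. -/
def empiricalMeasure {d n : ℕ} (x : Fin n → EuclideanSpace ℝ (Fin d)) :
    Measure (EuclideanSpace ℝ (Fin d)) :=
  (n : ℝ≥0∞)⁻¹ • ∑ i, Measure.dirac (x i)

/-- The score `∇ p_σ / p_σ` of the smoothed distribution `P * N(0, σ² I_d)`. -/
def score {d : ℕ} (P : Measure (EuclideanSpace ℝ (Fin d))) (σ : ℝ)
    (x : EuclideanSpace ℝ (Fin d)) : EuclideanSpace ℝ (Fin d) :=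
  (smoothedDensity P σ x)⁻¹ • gradient (smoothedDensity P σ) x

/-- The regularized score `∇ q_σ / (q_σ ∨ ρ)` of the smoothed distribution `Q * N(0, σ² I_d)`. -/
def regularizedScore {d : ℕ} (Q : Measure (EuclideanSpace ℝ (Fin d))) (σ ρ : ℝ)
    (x : EuclideanSpace ℝ (Fin d)) : EuclideanSpace ℝ (Fin d) :=
  (max (smoothedDensity Q σ x) ρ)⁻¹ • gradient (smoothedDensity Q σ) x

/-- The score matching loss
`∫ ‖∇ p_σ / p_σ - ∇ q_σ / (q_σ ∨ ρ)‖² p_σ(x) dx`, as an element of `[0, ∞]`. -/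
def scoreMatchingLoss {d : ℕ} (P Q : Measure (EuclideanSpace ℝ (Fin d))) (σ ρ : ℝ) : ℝ≥0∞ :=
  ∫⁻ x, ENNReal.ofReal
    (‖score P σ x - regularizedScore Q σ ρ x‖ ^ 2 * smoothedDensity P σ x)

/-- The expectation, over an i.i.d. sample of size `n` drawn from `P`, of the score matching loss
between the score of `P * N(0, σ² I_d)` and the regularized score of the smoothed empirical
distribution, as an element of `[0, ∞]`. -/
def expectedLoss {d : ℕ} (P : Measure (EuclideanSpace ℝ (Fin d))) (n : ℕ) (σ ρ : ℝ) : ℝ≥0∞ :=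
  ∫⁻ x : Fin n → EuclideanSpace ℝ (Fin d),
    scoreMatchingLoss P (empiricalMeasure x) σ ρ ∂(Measure.pi fun _ => P)

/-! Checks that the densities above are the densities of the smoothed distributions. -/

theorem gaussianDensity_nonneg {d : ℕ} (σ : ℝ) (x : EuclideanSpace ℝ (Fin d)) :
    0 ≤ gaussianDensity σ x := by
  unfold gaussianDensity; positivity

theorem continuous_gaussianDensity {d : ℕ} (σ : ℝ) :
    Continuous (gaussianDensity σ : EuclideanSpace ℝ (Fin d) → ℝ) := by
  unfold gaussianDensity; fun_prop

theorem gaussianDensity_le {d : ℕ} (σ : ℝ) (x : EuclideanSpace ℝ (Fin d)) :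
    gaussianDensity σ x ≤ (2 * Real.pi * σ ^ 2) ^ (-(d : ℝ) / 2) := by
  unfold gaussianDensity
  refine mul_le_of_le_one_right (by positivity) (Real.exp_le_one_iff.2 ?_)
  rw [neg_div, neg_nonpos]
  positivity

theorem gaussianMeasure_eq_withDensity {d : ℕ} {σ : ℝ} (hσ : 0 < σ) :
    gaussianMeasure d σ = (volume : Measure (EuclideanSpace ℝ (Fin d))).withDensity
      (fun x => ENNReal.ofReal (gaussianDensity σ x)) := by
  have hb : 0 < 1 / (2 * σ ^ 2) := by positivity
  have hpos : (0 : ℝ) < 2 * Real.pi * σ ^ 2 := by positivity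
  have hint : Integrable (gaussianDensity σ : EuclideanSpace ℝ (Fin d) → ℝ) := by
    have h := GaussianFourier.integrable_cexp_neg_mul_sq_norm_add
      (V := EuclideanSpace ℝ (Fin d)) (b := ((1 / (2 * σ ^ 2) : ℝ) : ℂ)) (by rw [Complex.ofReal_re]; exact hb) 0 0
    refine (h.norm.const_mul ((2 * Real.pi * σ ^ 2) ^ (-(d : ℝ) / 2))).congr
      (Filter.Eventually.of_forall fun x => ?_)
    simp only [gaussianDensity, Complex.norm_exp]
    congr 2
    simp only [zero_mul, add_zero]
    norm_cast
    ring
  have hfin : IsFiniteMeasure ((volume : Measure (EuclideanSpace ℝ (Fin d))).withDensity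
      (fun x => ENNReal.ofReal (gaussianDensity σ x))) :=
    isFiniteMeasure_withDensity_ofReal hint.2
  unfold gaussianMeasure
  refine Measure.ext_of_charFun ?_
  funext t
  have hS : (σ ^ 2 • (1 : Matrix (Fin d) (Fin d) ℝ)).PosSemidef :=
    Matrix.PosSemidef.one.smul (by positivity)
  rw [ProbabilityTheory.charFun_multivariateGaussian hS, charFun_apply,
    integral_withDensity_eq_integral_toReal_smul₀
      (continuous_gaussianDensity σ).measurable.ennreal_ofReal.aemeasurable
      (Filter.Eventually.of_forall fun x => ENNReal.ofReal_lt_top)]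
  have h := GaussianFourier.integral_cexp_neg_mul_sq_norm_add
      (V := EuclideanSpace ℝ (Fin d)) (b := ((1 / (2 * σ ^ 2) : ℝ) : ℂ))
      (by rw [Complex.ofReal_re]; exact hb) Complex.I t
  have e : ∀ x : EuclideanSpace ℝ (Fin d),
      (ENNReal.ofReal (gaussianDensity σ x)).toReal • Complex.exp (⟪x, t⟫ * Complex.I) =
      (((2 * Real.pi * σ ^ 2) ^ (-(d : ℝ) / 2) : ℝ) : ℂ) *
        Complex.exp (-((1 / (2 * σ ^ 2) : ℝ) : ℂ) * ‖x‖ ^ 2 + Complex.I * ⟪t, x⟫) := by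
    intro x
    rw [ENNReal.toReal_ofReal (gaussianDensity_nonneg σ x), gaussianDensity, Complex.exp_add,
      real_inner_comm, Complex.real_smul]
    push_cast
    rw [mul_assoc]
    congr 2
    · congr 1
      ring
    · rw [mul_comm]
  simp_rw [e]
  rw [integral_const_mul, h, ← mul_assoc]
  have hc : (((2 * Real.pi * σ ^ 2) ^ (-(d : ℝ) / 2) : ℝ) : ℂ) *
      ((Real.pi : ℂ) / ((1 / (2 * σ ^ 2) : ℝ) : ℂ)) ^
        (Module.finrank ℝ (EuclideanSpace ℝ (Fin d)) / 2 : ℂ) = 1 := by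
    have h1 : ((Real.pi : ℂ) / ((1 / (2 * σ ^ 2) : ℝ) : ℂ)) =
        ((2 * Real.pi * σ ^ 2 : ℝ) : ℂ) := by
      push_cast
      field_simp
    have h2 : (Module.finrank ℝ (EuclideanSpace ℝ (Fin d)) / 2 : ℂ) = (((d : ℝ) / 2 : ℝ) : ℂ) := by
      simp
    rw [h1, h2, ← Complex.ofReal_cpow hpos.le, ← Complex.ofReal_mul, ← Real.rpow_add hpos]
    simp [neg_div]
  rw [hc, one_mul]
  congr 1
  have hdot : (t.ofLp ⬝ᵥ Matrix.mulVec (σ ^ 2 • (1 : Matrix (Fin d) (Fin d) ℝ)) t.ofLp) =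
      σ ^ 2 * ‖t‖ ^ 2 := by
    rw [Matrix.smul_mulVec, Matrix.one_mulVec, dotProduct_smul, EuclideanSpace.norm_sq_eq]
    simp [dotProduct, sq]
  rw [hdot]
  have hσ' : (σ : ℂ) ≠ 0 := by exact_mod_cast hσ.ne'
  push_cast
  simp only [inner_zero_right, Complex.ofReal_zero, zero_mul, zero_sub, Complex.I_sq]
  field_simp
  ring

/-- `smoothedDensity P σ` is a density of `P * N(0, σ² I_d)`. -/
theorem conv_gaussianMeasure_eq_withDensity {d : ℕ} (P : Measure (EuclideanSpace ℝ (Fin d)))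
    [IsProbabilityMeasure P] {σ : ℝ} (hσ : 0 < σ) :
    Measure.conv P (gaussianMeasure d σ) =
      volume.withDensity (fun x => ENNReal.ofReal (smoothedDensity P σ x)) := by
  have hm : Measurable (fun x : EuclideanSpace ℝ (Fin d) => ENNReal.ofReal (gaussianDensity σ x)) :=
    (continuous_gaussianDensity σ).measurable.ennreal_ofReal
  have hprob : IsProbabilityMeasure (gaussianMeasure d σ) := by
    unfold gaussianMeasure; infer_instance
  have hd : ∀ x : EuclideanSpace ℝ (Fin d), ENNReal.ofReal (smoothedDensity P σ x) =
      ∫⁻ y, ENNReal.ofReal (gaussianDensity σ (x - y)) ∂P := by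
    intro x
    refine ofReal_integral_eq_lintegral_ofReal ?_
      (Filter.Eventually.of_forall fun y => gaussianDensity_nonneg σ _)
    refine Integrable.of_bound (C := (2 * Real.pi * σ ^ 2) ^ (-(d : ℝ) / 2))
      ((continuous_gaussianDensity σ).comp
        (continuous_const.sub continuous_id)).aestronglyMeasurable
      (Filter.Eventually.of_forall fun y => ?_)
    rw [Real.norm_of_nonneg (gaussianDensity_nonneg σ _)]
    exact gaussianDensity_le σ _
  refine Measure.ext_of_lintegral _ fun f hf => ?_
  rw [Measure.lintegral_conv hf]
  simp_rw [hd]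
  have hm2 : Measurable (fun z : EuclideanSpace ℝ (Fin d) × EuclideanSpace ℝ (Fin d) =>
      ENNReal.ofReal (gaussianDensity σ (z.1 - z.2))) :=
    hm.comp (measurable_fst.sub measurable_snd)
  rw [lintegral_withDensity_eq_lintegral_mul _ hm2.lintegral_prod_right' hf]
  simp only [Pi.mul_apply]
  have e1 : ∀ y : EuclideanSpace ℝ (Fin d), ∫⁻ z, f (y + z) ∂(gaussianMeasure d σ) =
      ∫⁻ x, ENNReal.ofReal (gaussianDensity σ (x - y)) * f x := by
    intro y
    have e2 := lintegral_withDensity_eq_lintegral_mul volume hm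
      (hf.comp (measurable_const_add y))
    simp only [Function.comp_apply, Pi.mul_apply] at e2
    rw [gaussianMeasure_eq_withDensity hσ, e2]
    rw [← lintegral_add_left_eq_self
      (fun x => ENNReal.ofReal (gaussianDensity σ (x - y)) * f x) y]
    simp
  simp_rw [e1]
  rw [lintegral_lintegral_swap]
  · refine lintegral_congr fun x => ?_
    rw [lintegral_mul_const]
    exact hm.comp (measurable_const.sub measurable_id)
  · exact ((hm.comp (measurable_snd.sub measurable_fst)).mul
      (hf.comp measurable_snd)).aemeasurable

/-- The smoothed empirical density is the Gaussian kernel density estimator. -/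
theorem smoothedDensity_empiricalMeasure {d n : ℕ} (x : Fin n → EuclideanSpace ℝ (Fin d)) (σ : ℝ)
    (z : EuclideanSpace ℝ (Fin d)) :
    smoothedDensity (empiricalMeasure x) σ z = (n : ℝ)⁻¹ * ∑ i, gaussianDensity σ (z - x i) := by
  unfold smoothedDensity empiricalMeasure
  rw [integral_smul_measure, integral_finsetSum_measure]
  · simp
  · intro i _
    exact integrable_dirac (by simp)

end SubGaussianScore

end

/-! Write `M` for the peak of the Gaussian kernel, `p` for the true smoothed density, `m` for the
mean of `P`, and `L = log (M / ρ)`. The expectation and the `z`-integral are exchanged, and the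
expected loss is bounded at each `z`. Two facts drive the pointwise bound. First, the score of any
smoothed probability measure with density `q` has squared norm at most `(2 / σ²) log (M / q)`: it is
an average of `-(z - y) / σ²` under a tilted law, and concavity of `u log (M / u)` controls the
second moment (`sq_norm_gradient_smoothedDensity_le`). Regularization replaces this by `(2 / σ²) L`.
Second, the variances of the empirical density and of its gradient at `z` are at most multiples of
`M p(z) / n`, so dividing by `p(z)` leaves no dependence on `z`. Where `p ≥ ρ`, the variances give a
loss of order `L M / (σ² n)`; where `p ≤ ρ`, the score bounds give the same order because `ρ ≤ M /
n` (`pointwiseLoss_le`). Far from the mean, the sub-Gaussian envelope `p ≤ M exp (-w)`, with `w = ‖z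
- m‖² / (2 (σ² + α²))`, beats `1 / n` and leaves decay to spare (`pointwiseLoss_le_tail`). Both
regimes fit under one Gaussian profile whose variance is inflated by `log n`
(`pointwiseLoss_le_gaussian`). Its integral produces `(σ^d + α^d) log^{d/2} n`, with `L` only to the
first power. -/

namespace SubGaussianScore

variable {d : ℕ}

/-! ### Pointwise bounds for the Gaussian kernel and its gradient -/

/-- The maximum `φ_σ(0) = (2πσ²)^{-d/2}` of the Gaussian density. -/
noncomputable def gaussianPeak (d : ℕ) (σ : ℝ) : ℝ := (2 * Real.pi * σ ^ 2) ^ (-(d : ℝ) / 2)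

/-- The gradient of the Gaussian density. -/
noncomputable def gaussianGradient (σ : ℝ) (v : EuclideanSpace ℝ (Fin d)) :
    EuclideanSpace ℝ (Fin d) :=
  (-(gaussianDensity σ v / σ ^ 2)) • v

theorem gaussianPeak_pos {σ : ℝ} (hσ : 0 < σ) : 0 < gaussianPeak d σ := by
  unfold gaussianPeak; positivity

theorem gaussianDensity_pos {σ : ℝ} (hσ : 0 < σ) (v : EuclideanSpace ℝ (Fin d)) :
    0 < gaussianDensity σ v := by
  unfold gaussianDensity; positivity

theorem gaussianDensity_eq (σ : ℝ) (v : EuclideanSpace ℝ (Fin d)) :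
    gaussianDensity σ v = gaussianPeak d σ * Real.exp (-(‖v‖ ^ 2 / (2 * σ ^ 2))) := by
  rw [gaussianDensity, gaussianPeak, neg_div (2 * σ ^ 2)]

theorem gaussianDensity_le_peak (σ : ℝ) (v : EuclideanSpace ℝ (Fin d)) :
    gaussianDensity σ v ≤ gaussianPeak d σ :=
  gaussianDensity_le σ v

theorem continuous_gaussianGradient (σ : ℝ) :
    Continuous (gaussianGradient σ : EuclideanSpace ℝ (Fin d) → _) := by
  have := continuous_gaussianDensity (d := d) σ
  unfold gaussianGradient
  fun_prop

/-- Squared distance is a log-density ratio, which turns second moments into entropies. -/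
theorem sq_norm_eq_log {σ : ℝ} (hσ : 0 < σ) (v : EuclideanSpace ℝ (Fin d)) :
    ‖v‖ ^ 2 = 2 * σ ^ 2 * Real.log (gaussianPeak d σ / gaussianDensity σ v) := by
  have hM := gaussianPeak_pos (d := d) hσ
  rw [gaussianDensity_eq, ← div_div, div_self hM.ne', one_div, Real.log_inv, Real.log_exp]
  field_simp

theorem sq_norm_mul_gaussianDensity_le {σ : ℝ} (hσ : 0 < σ) (v : EuclideanSpace ℝ (Fin d)) :
    ‖v‖ ^ 2 * gaussianDensity σ v ≤ 2 * σ ^ 2 * gaussianPeak d σ := by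
  have hM := gaussianPeak_pos (d := d) hσ
  set t := ‖v‖ ^ 2 / (2 * σ ^ 2) with ht
  have e : ‖v‖ ^ 2 = 2 * σ ^ 2 * t := by rw [ht]; field_simp
  have h1 : t * Real.exp (-t) ≤ 1 := by
    have h := Real.add_one_le_exp t
    rw [Real.exp_neg, ← div_eq_mul_inv, div_le_one (Real.exp_pos t)]
    linarith
  rw [gaussianDensity_eq, ← ht, e]
  calc 2 * σ ^ 2 * t * (gaussianPeak d σ * Real.exp (-t))
      = 2 * σ ^ 2 * gaussianPeak d σ * (t * Real.exp (-t)) := by ring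
    _ ≤ 2 * σ ^ 2 * gaussianPeak d σ * 1 := by gcongr
    _ = _ := mul_one _

theorem norm_gaussianGradient {σ : ℝ} (v : EuclideanSpace ℝ (Fin d)) :
    ‖gaussianGradient σ v‖ = gaussianDensity σ v * ‖v‖ / σ ^ 2 := by
  rw [gaussianGradient, norm_smul, norm_neg, Real.norm_of_nonneg
    (div_nonneg (gaussianDensity_nonneg σ v) (sq_nonneg σ))]
  ring

/-- One factor of the density is spent on absorbing `‖v‖²`; the other is kept, so that integrating
against `P` yields a multiple of the smoothed density. -/
theorem sq_norm_gaussianGradient_le {σ : ℝ} (hσ : 0 < σ) (v : EuclideanSpace ℝ (Fin d)) :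
    ‖gaussianGradient σ v‖ ^ 2 ≤ 2 * gaussianPeak d σ / σ ^ 2 * gaussianDensity σ v := by
  have h := sq_norm_mul_gaussianDensity_le hσ v
  have h0 := gaussianDensity_nonneg σ v
  rw [norm_gaussianGradient]
  calc (gaussianDensity σ v * ‖v‖ / σ ^ 2) ^ 2
      = (‖v‖ ^ 2 * gaussianDensity σ v) * gaussianDensity σ v / σ ^ 4 := by ring
    _ ≤ (2 * σ ^ 2 * gaussianPeak d σ) * gaussianDensity σ v / σ ^ 4 := by gcongr
    _ = _ := by field_simp

theorem norm_gaussianGradient_le {σ : ℝ} (hσ : 0 < σ) (v : EuclideanSpace ℝ (Fin d)) :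
    ‖gaussianGradient σ v‖ ≤ √(2 * gaussianPeak d σ / σ ^ 2 * gaussianPeak d σ) := by
  have hM := gaussianPeak_pos (d := d) hσ
  refine Real.le_sqrt_of_sq_le ((sq_norm_gaussianGradient_le hσ v).trans ?_)
  gcongr
  exact gaussianDensity_le_peak σ v

theorem hasGradientAt_gaussianDensity {σ : ℝ} (hσ : 0 < σ) (v : EuclideanSpace ℝ (Fin d)) :
    HasGradientAt (gaussianDensity σ) (gaussianGradient σ v) v := by
  rw [hasGradientAt_iff_hasFDerivAt]
  have h1 : HasFDerivAt (fun x : EuclideanSpace ℝ (Fin d) => ‖x‖ ^ 2) (2 • innerSL ℝ v) v :=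
    (hasStrictFDerivAt_norm_sq v).hasFDerivAt
  have h2 := ((h1.fun_neg.mul_const (2 * σ ^ 2)⁻¹).exp).const_mul (gaussianPeak d σ)
  have hf : (gaussianDensity σ : EuclideanSpace ℝ (Fin d) → ℝ) =
      fun y => gaussianPeak d σ * Real.exp (-‖y‖ ^ 2 * (2 * σ ^ 2)⁻¹) := by
    funext y
    rw [gaussianDensity_eq, neg_mul, div_eq_mul_inv]
  have hv := congrFun hf v
  rw [hf]
  refine h2.congr_fderiv (ContinuousLinearMap.ext fun w => ?_)
  simp only [gaussianGradient, hv, InnerProductSpace.toDual_apply_apply, inner_smul_left,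
    smul_apply, neg_apply, innerSL_apply_apply, smul_eq_mul, nsmul_eq_mul, conj_trivial]
  push_cast
  field_simp

/-! ### Smoothed densities of an arbitrary probability measure, later both `P` and the empirical
measure -/

section Smoothed

variable (Q : Measure (EuclideanSpace ℝ (Fin d))) [IsProbabilityMeasure Q]

theorem integrable_gaussianDensity_sub (σ : ℝ) (z : EuclideanSpace ℝ (Fin d)) :
    Integrable (fun y => gaussianDensity σ (z - y)) Q := by
  refine Integrable.of_bound (C := gaussianPeak d σ) ((continuous_gaussianDensity σ).comp
    (continuous_const.sub continuous_id)).aestronglyMeasurable (.of_forall fun y => ?_)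
  rw [Real.norm_of_nonneg (gaussianDensity_nonneg σ _)]
  exact gaussianDensity_le_peak σ _

theorem integrable_gaussianGradient_sub {σ : ℝ} (hσ : 0 < σ) (z : EuclideanSpace ℝ (Fin d)) :
    Integrable (fun y => gaussianGradient σ (z - y)) Q :=
  Integrable.of_bound ((continuous_gaussianGradient σ).comp
    (continuous_const.sub continuous_id)).aestronglyMeasurable _
    (.of_forall fun y => norm_gaussianGradient_le hσ (z - y))

theorem hasGradientAt_smoothedDensity {σ : ℝ} (hσ : 0 < σ) (z : EuclideanSpace ℝ (Fin d)) :
    HasGradientAt (smoothedDensity Q σ) (∫ y, gaussianGradient σ (z - y) ∂Q) z := by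
  rw [hasGradientAt_iff_hasFDerivAt]
  have hc : Continuous fun y => InnerProductSpace.toDual ℝ (EuclideanSpace ℝ (Fin d))
      (gaussianGradient σ (z - y)) :=
    (LinearIsometryEquiv.continuous _).comp
      ((continuous_gaussianGradient σ).comp (continuous_const.sub continuous_id))
  have hb : ∀ x y, ‖InnerProductSpace.toDual ℝ (EuclideanSpace ℝ (Fin d))
      (gaussianGradient σ (x - y))‖ ≤ √(2 * gaussianPeak d σ / σ ^ 2 * gaussianPeak d σ) := by
    intro x y
    rw [LinearIsometryEquiv.norm_map]
    exact norm_gaussianGradient_le hσ _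
  have h := hasFDerivAt_integral_of_dominated_of_fderiv_le (μ := Q) (𝕜 := ℝ) (x₀ := z)
    (F := fun x y => gaussianDensity σ (x - y))
    (F' := fun x y => InnerProductSpace.toDual ℝ (EuclideanSpace ℝ (Fin d))
      (gaussianGradient σ (x - y)))
    (bound := fun _ => √(2 * gaussianPeak d σ / σ ^ 2 * gaussianPeak d σ)) Filter.univ_mem
    (.of_forall fun x => (integrable_gaussianDensity_sub Q σ x).aestronglyMeasurable)
    (integrable_gaussianDensity_sub Q σ z) hc.aestronglyMeasurable
    (.of_forall fun y x _ => hb x y) (integrable_const _)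
    (.of_forall fun y x _ => by
      simpa [Function.comp_def] using (hasGradientAt_gaussianDensity hσ (x - y)).hasFDerivAt.comp x
        ((hasFDerivAt_id x).sub_const y))
  refine h.congr_fderiv (ContinuousLinearMap.ext fun w => ?_)
  rw [ContinuousLinearMap.integral_apply
    (Integrable.of_bound hc.aestronglyMeasurable _ (.of_forall fun y => hb z y))]
  simp only [InnerProductSpace.toDual_apply_apply]
  rw [real_inner_comm, ← integral_inner (integrable_gaussianGradient_sub Q hσ z)]
  simp only [real_inner_comm]

theorem gradient_smoothedDensity {σ : ℝ} (hσ : 0 < σ) (z : EuclideanSpace ℝ (Fin d)) :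
    gradient (smoothedDensity Q σ) z = ∫ y, gaussianGradient σ (z - y) ∂Q :=
  (hasGradientAt_smoothedDensity Q hσ z).gradient

theorem smoothedDensity_pos {σ : ℝ} (hσ : 0 < σ) (z : EuclideanSpace ℝ (Fin d)) :
    0 < smoothedDensity Q σ z := by
  refine (integral_pos_iff_support_of_nonneg (fun y => gaussianDensity_nonneg σ _)
    (integrable_gaussianDensity_sub Q σ z)).2 ?_
  have : Function.support (fun y => gaussianDensity σ (z - y)) = Set.univ :=
    Set.eq_univ_of_forall fun y => (gaussianDensity_pos hσ (z - y)).ne'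
  rw [this]
  simp

theorem smoothedDensity_le_peak (σ : ℝ) (z : EuclideanSpace ℝ (Fin d)) :
    smoothedDensity Q σ z ≤ gaussianPeak d σ := by
  have h := integral_mono (integrable_gaussianDensity_sub Q σ z)
    (integrable_const (μ := Q) (gaussianPeak d σ)) fun y => gaussianDensity_le_peak σ (z - y)
  simpa [smoothedDensity] using h

/-- The entropy bound `∫ φ log (M / φ) ≤ q log (M / q)`, in terms of the second moment. -/
theorem integral_sq_norm_mul_gaussianDensity_le {σ : ℝ} (hσ : 0 < σ)
    (z : EuclideanSpace ℝ (Fin d)) :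
    ∫ y, ‖z - y‖ ^ 2 * gaussianDensity σ (z - y) ∂Q ≤
      2 * σ ^ 2 * (smoothedDensity Q σ z *
        Real.log (gaussianPeak d σ / smoothedDensity Q σ z)) := by
  have hM := gaussianPeak_pos (d := d) hσ
  have hq := smoothedDensity_pos Q hσ z
  set q := smoothedDensity Q σ z
  have hi := integrable_gaussianDensity_sub Q σ z
  -- Jensen by a tangent line: the right side is the tangent at `q` to the concave function `u ↦ u
  -- log (M / u)`, and its integral equals the value at `q`.
  have key : ∀ y, ‖z - y‖ ^ 2 * gaussianDensity σ (z - y) ≤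
      2 * σ ^ 2 * (gaussianDensity σ (z - y) * (Real.log (gaussianPeak d σ / q) - 1) + q) := by
    intro y
    have hφ := gaussianDensity_pos hσ (z - y)
    have h1 := Real.log_le_sub_one_of_pos (div_pos hq hφ)
    rw [sq_norm_eq_log hσ, mul_assoc]
    gcongr
    have h2 : Real.log (gaussianPeak d σ / gaussianDensity σ (z - y)) =
        Real.log (gaussianPeak d σ / q) + Real.log (q / gaussianDensity σ (z - y)) := by
      rw [← Real.log_mul (div_pos hM hq).ne' (div_pos hq hφ).ne']
      congr 1
      field_simp
    rw [h2]
    have h3 : gaussianDensity σ (z - y) * (q / gaussianDensity σ (z - y)) = q := by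
      field_simp
    nlinarith
  calc ∫ y, ‖z - y‖ ^ 2 * gaussianDensity σ (z - y) ∂Q
      ≤ ∫ y, 2 * σ ^ 2 * (gaussianDensity σ (z - y) * (Real.log (gaussianPeak d σ / q) - 1) + q) ∂Q :=
        integral_mono_of_nonneg
          (.of_forall fun y => mul_nonneg (sq_nonneg _) (gaussianDensity_nonneg σ _))
          (((hi.mul_const _).add (integrable_const _)).const_mul _) (.of_forall key)
    _ = _ := by
        rw [integral_const_mul, integral_add (hi.mul_const _) (integrable_const _),
          integral_mul_const, integral_const]
        change 2 * σ ^ 2 * (q * _ + _) = _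
        simp only [probReal_univ, one_smul]
        ring

/-- Cauchy–Schwarz bounds the gradient by the density times the weighted second moment of `z - y`,
and the entropy bound estimates that moment. -/
theorem sq_norm_gradient_smoothedDensity_le {σ : ℝ} (hσ : 0 < σ) (z : EuclideanSpace ℝ (Fin d)) :
    ‖gradient (smoothedDensity Q σ) z‖ ^ 2 ≤ smoothedDensity Q σ z ^ 2 *
      (2 / σ ^ 2 * Real.log (gaussianPeak d σ / smoothedDensity Q σ z)) := by
  have hq := smoothedDensity_pos Q hσ z
  have hA := integral_sq_norm_mul_gaussianDensity_le Q hσ z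
  have hi := integrable_gaussianDensity_sub Q σ z
  rw [gradient_smoothedDensity Q hσ]
  set N := ∫ y, ‖gaussianGradient σ (z - y)‖ ∂Q
  have hNi := (integrable_gaussianGradient_sub Q hσ z).norm
  have hAi : Integrable (fun y => ‖z - y‖ ^ 2 * gaussianDensity σ (z - y)) Q := by
    refine Integrable.of_bound (C := 2 * σ ^ 2 * gaussianPeak d σ)
      (((continuous_const.sub continuous_id).norm.pow 2).mul ((continuous_gaussianDensity σ).comp
        (continuous_const.sub continuous_id))).aestronglyMeasurable (.of_forall fun y => ?_)
    rw [Real.norm_of_nonneg (mul_nonneg (sq_nonneg _) (gaussianDensity_nonneg σ _))]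
    exact sq_norm_mul_gaussianDensity_le hσ _
  have hq' : ∫ y, gaussianDensity σ (z - y) ∂Q = smoothedDensity Q σ z := rfl
  set q := smoothedDensity Q σ z
  set A := ∫ y, ‖z - y‖ ^ 2 * gaussianDensity σ (z - y) ∂Q
  -- Cauchy–Schwarz as nonnegativity of `∫ φ (‖z - y‖ / σ² - t)²` at its minimizer `t = N / q`.
  have hcs : 0 ≤ A / σ ^ 4 - 2 * (N / q) * N + (N / q) ^ 2 * q := by
    have h : 0 ≤ ∫ y, ((‖z - y‖ ^ 2 * gaussianDensity σ (z - y)) / σ ^ 4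
        - 2 * (N / q) * ‖gaussianGradient σ (z - y)‖
        + (N / q) ^ 2 * gaussianDensity σ (z - y)) ∂Q := by
      refine integral_nonneg fun y => ?_
      have h0 := mul_nonneg (gaussianDensity_nonneg σ (z - y))
        (sq_nonneg (‖z - y‖ / σ ^ 2 - N / q))
      simp only [Pi.zero_apply, norm_gaussianGradient]
      refine h0.trans_eq ?_
      ring
    have hs : Integrable (fun y => (‖z - y‖ ^ 2 * gaussianDensity σ (z - y)) / σ ^ 4
        - 2 * (N / q) * ‖gaussianGradient σ (z - y)‖) Q :=
      (hAi.div_const _).sub (hNi.const_mul _)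
    rw [integral_add hs (hi.const_mul _),
      integral_sub (hAi.div_const _) (hNi.const_mul _), integral_div, integral_const_mul,
      integral_const_mul, hq'] at h
    exact h
  have h1 : N ^ 2 ≤ q * (A / σ ^ 4) := by
    have e : 2 * (N / q) * N - (N / q) ^ 2 * q = N ^ 2 / q := by field_simp; ring
    have : N ^ 2 / q ≤ A / σ ^ 4 := by linarith
    rw [div_le_iff₀ hq] at this
    linarith
  calc ‖∫ y, gaussianGradient σ (z - y) ∂Q‖ ^ 2 ≤ N ^ 2 := by
        gcongr; exact norm_integral_le_integral_norm _
    _ ≤ q * (A / σ ^ 4) := h1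
    _ ≤ q * (2 * σ ^ 2 * (q * Real.log (gaussianPeak d σ / q)) / σ ^ 4) := by gcongr
    _ = _ := by field_simp

/-- `u ↦ u log (M / u)` is monotone on `(0, M / e]`, in the form needed for comparisons. -/
theorem mul_log_div_le {M u v : ℝ} (hM : 0 < M) (hu : 0 < u) (huv : u ≤ v)
    (hv : 1 ≤ Real.log (M / v)) : u * Real.log (M / u) ≤ v * Real.log (M / v) := by
  have hv0 : 0 < v := hu.trans_le huv
  have h1 : Real.log (M / u) = Real.log (M / v) + Real.log (v / u) := by
    rw [← Real.log_mul (div_pos hM hv0).ne' (div_pos hv0 hu).ne']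
    congr 1
    field_simp
  have h2 := Real.log_le_sub_one_of_pos (div_pos hv0 hu)
  have h3 : u * (v / u) = v := by field_simp
  rw [h1]
  nlinarith [mul_le_mul_of_nonneg_left h2 hu.le]

theorem sq_norm_score_le {σ : ℝ} (hσ : 0 < σ) (z : EuclideanSpace ℝ (Fin d)) :
    ‖score Q σ z‖ ^ 2 ≤
      2 / σ ^ 2 * Real.log (gaussianPeak d σ / smoothedDensity Q σ z) := by
  have hq := smoothedDensity_pos Q hσ z
  have h := sq_norm_gradient_smoothedDensity_le Q hσ z
  rw [score, norm_smul, mul_pow, norm_inv, Real.norm_of_nonneg hq.le, inv_pow,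
    inv_mul_le_iff₀ (by positivity)]
  exact h

/-- If `q ≥ ρ`, the logarithm only decreases when `q` replaces `ρ`. If `q ≤ ρ`, then `q · q log (M /
q) ≤ ρ · ρ L` by monotonicity of `u log (M / u)` below `M / e`. -/
theorem sq_norm_regularizedScore_le {σ ρ : ℝ} (hσ : 0 < σ) (hρ : 0 < ρ)
    (hL : 1 ≤ Real.log (gaussianPeak d σ / ρ)) (z : EuclideanSpace ℝ (Fin d)) :
    ‖regularizedScore Q σ ρ z‖ ^ 2 ≤ 2 / σ ^ 2 * Real.log (gaussianPeak d σ / ρ) := by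
  have hM := gaussianPeak_pos (d := d) hσ
  have hq := smoothedDensity_pos Q hσ z
  have h := sq_norm_gradient_smoothedDensity_le Q hσ z
  have hm : 0 < max (smoothedDensity Q σ z) ρ := lt_max_of_lt_right hρ
  rw [regularizedScore, norm_smul, mul_pow, norm_inv, Real.norm_of_nonneg hm.le, inv_pow,
    inv_mul_le_iff₀ (by positivity)]
  refine h.trans ?_
  rw [mul_left_comm, mul_left_comm _ (2 / σ ^ 2)]
  gcongr ?_ * ?_
  rcases le_total ρ (smoothedDensity Q σ z) with h1 | h1
  · rw [max_eq_left h1]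
    gcongr
  · rw [max_eq_right h1, sq, sq, mul_assoc, mul_assoc]
    have h2 := mul_log_div_le hM hq h1 hL
    exact mul_le_mul h1 h2 (mul_nonneg hq.le (Real.log_nonneg
      ((one_le_div hq).2 (smoothedDensity_le_peak Q σ z)))) hρ.le

theorem continuous_smoothedDensity (σ : ℝ) : Continuous (smoothedDensity Q σ) := by
  refine continuous_of_dominated (bound := fun _ => gaussianPeak d σ)
    (fun z => (integrable_gaussianDensity_sub Q σ z).aestronglyMeasurable)
    (fun z => .of_forall fun y => ?_) (integrable_const _)
    (.of_forall fun y => (continuous_gaussianDensity σ).comp (continuous_id.sub continuous_const))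
  rw [Real.norm_of_nonneg (gaussianDensity_nonneg σ _)]
  exact gaussianDensity_le_peak σ _

theorem continuous_gradient_smoothedDensity {σ : ℝ} (hσ : 0 < σ) :
    Continuous (gradient (smoothedDensity Q σ)) := by
  rw [funext (gradient_smoothedDensity Q hσ)]
  exact continuous_of_dominated
    (fun z => (integrable_gaussianGradient_sub Q hσ z).aestronglyMeasurable)
    (fun z => .of_forall fun y => norm_gaussianGradient_le hσ (z - y)) (integrable_const _)
    (.of_forall fun y => (continuous_gaussianGradient σ).comp (continuous_id.sub continuous_const))

end Smoothed

/-! ### Gaussian envelope for sub-Gaussian `P` -/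

/-- A sub-Gaussian distribution has a smoothed density dominated by a Gaussian profile. -/
theorem smoothedDensity_le_of_isSubGaussian {P : Measure (EuclideanSpace ℝ (Fin d))}
    [IsProbabilityMeasure P] {α σ : ℝ} (hP : IsSubGaussian P α) (hσ : 0 < σ)
    (z : EuclideanSpace ℝ (Fin d)) :
    smoothedDensity P σ z ≤ gaussianPeak d σ *
      Real.exp (-(‖z - ∫ y, y ∂P‖ ^ 2 / (2 * (σ ^ 2 + α ^ 2)))) := by
  set m := ∫ y, y ∂P
  have hM := gaussianPeak_pos (d := d) hσ
  have hτ : 0 < σ ^ 2 + α ^ 2 := by positivity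
  -- Chernoff's choice: this `θ` minimizes the final exponent `(σ² + α²) ‖θ‖² / 2 - ⟪θ, z - m⟫`.
  set θ := (σ ^ 2 + α ^ 2)⁻¹ • (z - m) with hθ
  have key : ∀ y, gaussianDensity σ (z - y) ≤ gaussianPeak d σ *
      Real.exp (σ ^ 2 * ‖θ‖ ^ 2 / 2 - ⟪θ, z - m⟫) * Real.exp ⟪θ, y - m⟫ := by
    intro y
    rw [gaussianDensity_eq, mul_assoc, ← Real.exp_add]
    gcongr
    -- Completing the square linearizes the Gaussian exponent in `y`, so that the moment generating
    -- function can be applied.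
    have h0 := sq_nonneg ‖z - y - σ ^ 2 • θ‖
    rw [norm_sub_sq_real, norm_smul, inner_smul_right, real_inner_comm] at h0
    have h1 : ⟪θ, z - y⟫ = ⟪θ, z - m⟫ - ⟪θ, y - m⟫ := by rw [← inner_sub_right]; congr 1; abel
    rw [h1, Real.norm_of_nonneg (sq_nonneg σ)] at h0
    have h2 : -(‖z - y‖ ^ 2 / (2 * σ ^ 2)) ≤
        -((2 * (σ ^ 2 * (⟪θ, z - m⟫ - ⟪θ, y - m⟫)) - (σ ^ 2 * ‖θ‖) ^ 2) / (2 * σ ^ 2)) := by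
      gcongr
      linarith
    refine h2.trans_eq ?_
    field_simp
    ring
  have hnθ : ‖θ‖ ^ 2 = ‖z - m‖ ^ 2 / (σ ^ 2 + α ^ 2) ^ 2 := by
    rw [hθ, norm_smul, norm_inv, Real.norm_of_nonneg hτ.le]
    field_simp
  have hin : ⟪θ, z - m⟫ = ‖z - m‖ ^ 2 / (σ ^ 2 + α ^ 2) := by
    rw [hθ, real_inner_smul_left, real_inner_self_eq_norm_sq]
    field_simp
  calc smoothedDensity P σ z
      ≤ ∫ y, gaussianPeak d σ * Real.exp (σ ^ 2 * ‖θ‖ ^ 2 / 2 - ⟪θ, z - m⟫) *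
          Real.exp ⟪θ, y - m⟫ ∂P :=
        integral_mono (integrable_gaussianDensity_sub P σ z) ((hP.integrable_exp θ).const_mul _) key
    _ ≤ gaussianPeak d σ * Real.exp (σ ^ 2 * ‖θ‖ ^ 2 / 2 - ⟪θ, z - m⟫) *
          Real.exp (α ^ 2 * ‖θ‖ ^ 2 / 2) := by
        rw [integral_const_mul]
        gcongr
        exact hP.mgf_le θ
    _ = _ := by
        rw [mul_assoc, ← Real.exp_add, hin, hnθ]
        congr 2
        field_simp
        ring

/-! ### Mean square error of empirical averages -/

section Variance

variable {Ω : Type*} [MeasurableSpace Ω] (P : Measure Ω) [IsProbabilityMeasure P] {n : ℕ}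

/-- By independence the variance of the average is the single-sample variance over `n`, and the
variance is at most the second moment. -/
theorem lintegral_sq_mean_sub_integral_le (hn : 0 < n) {f : Ω → ℝ} (hf : MemLp f 2 P) :
    ∫⁻ x : Fin n → Ω, ENNReal.ofReal (((n : ℝ)⁻¹ * ∑ i, f (x i) - ∫ y, f y ∂P) ^ 2)
      ∂(Measure.pi fun _ => P) ≤ ENNReal.ofReal ((n : ℝ)⁻¹ * ∫ y, f y ^ 2 ∂P) := by
  have hn0 : (n : ℝ) ≠ 0 := by positivity
  have hfi : ∀ i : Fin n, MemLp (fun x : Fin n → Ω => f (x i)) 2 (Measure.pi fun _ => P) :=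
    fun i => hf.comp_measurePreserving (measurePreserving_eval (fun _ => P) i)
  have hX : MemLp (fun x : Fin n → Ω => (n : ℝ)⁻¹ * ∑ i, f (x i)) 2 (Measure.pi fun _ => P) :=
    (memLp_finsetSum _ fun i _ => hfi i).const_mul _
  have hmean : ∫ x : Fin n → Ω, (n : ℝ)⁻¹ * ∑ i, f (x i) ∂(Measure.pi fun _ => P) =
      ∫ y, f y ∂P := by
    rw [integral_const_mul, integral_finsetSum _ fun i _ => (hfi i).integrable one_le_two]
    have : ∀ i : Fin n, ∫ x : Fin n → Ω, f (x i) ∂(Measure.pi fun _ => P) = ∫ y, f y ∂P :=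
      fun i => integral_comp_eval hf.aestronglyMeasurable
    simp [this, hn0]
  rw [← hmean, ← ProbabilityTheory.evariance_eq_lintegral_ofReal, ← hX.ofReal_variance_eq]
  refine ENNReal.ofReal_le_ofReal ?_
  rw [ProbabilityTheory.variance_const_mul]
  have hsum := ProbabilityTheory.variance_sum_pi (μ := fun _ : Fin n => P) (X := fun _ => f)
    fun _ => hf
  have e : (fun x : Fin n → Ω => ∑ i, f (x i)) = ∑ i, fun x : Fin n → Ω => f (x i) := by
    ext x; simp
  rw [e, hsum, Finset.sum_const, Finset.card_univ, Fintype.card_fin, nsmul_eq_mul]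
  have hv := ProbabilityTheory.variance_le_expectation_sq hf.aestronglyMeasurable
  calc (n : ℝ)⁻¹ ^ 2 * (n * ProbabilityTheory.variance f P)
      = (n : ℝ)⁻¹ * ProbabilityTheory.variance f P := by field_simp
    _ ≤ (n : ℝ)⁻¹ * ∫ y, f y ^ 2 ∂P := by gcongr; exact hv

theorem lintegral_sq_norm_mean_sub_integral_le {d : ℕ} (hn : 0 < n)
    {f : Ω → EuclideanSpace ℝ (Fin d)} (hf : MemLp f 2 P) :
    ∫⁻ x : Fin n → Ω, ENNReal.ofReal (‖(n : ℝ)⁻¹ • ∑ i, f (x i) - ∫ y, f y ∂P‖ ^ 2)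
      ∂(Measure.pi fun _ => P) ≤ ENNReal.ofReal ((n : ℝ)⁻¹ * ∫ y, ‖f y‖ ^ 2 ∂P) := by
  have hk : ∀ k, MemLp (fun y => f y k) 2 P := fun k => hf.eval_piLp k
  have hint : ∀ k, (∫ y, f y ∂P) k = ∫ y, f y k ∂P := fun k =>
    eval_integral_piLp (fun j => (hk j).integrable one_le_two) k
  have e1 : ∀ x : Fin n → Ω, ENNReal.ofReal (‖(n : ℝ)⁻¹ • ∑ i, f (x i) - ∫ y, f y ∂P‖ ^ 2) =
      ∑ k, ENNReal.ofReal (((n : ℝ)⁻¹ * ∑ i, f (x i) k - ∫ y, f y k ∂P) ^ 2) := by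
    intro x
    rw [EuclideanSpace.norm_sq_eq, ENNReal.ofReal_sum_of_nonneg fun _ _ => sq_nonneg _]
    refine Finset.sum_congr rfl fun k _ => ?_
    simp [hint]
  have e2 : (n : ℝ)⁻¹ * ∫ y, ‖f y‖ ^ 2 ∂P = ∑ k, (n : ℝ)⁻¹ * ∫ y, f y k ^ 2 ∂P := by
    simp_rw [EuclideanSpace.norm_sq_eq, Real.norm_eq_abs, sq_abs]
    rw [integral_finsetSum _ fun k _ => (hk k).integrable_sq, Finset.mul_sum]
  simp_rw [e1]
  have hle : ∀ k, ∫⁻ x : Fin n → Ω, ENNReal.ofReal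
      (((n : ℝ)⁻¹ * ∑ i, f (x i) k - ∫ y, f y k ∂P) ^ 2) ∂(Measure.pi fun _ => P) ≤
      ENNReal.ofReal ((n : ℝ)⁻¹ * ∫ y, f y k ^ 2 ∂P) := fun k =>
    lintegral_sq_mean_sub_integral_le P hn (f := fun y => f y k) (hk k)
  have h0 : ∀ k, 0 ≤ (n : ℝ)⁻¹ * ∫ y, f y k ^ 2 ∂P := fun k =>
    mul_nonneg (by positivity) (integral_nonneg fun y => sq_nonneg (f y k))
  rw [lintegral_finsetSum', e2, ENNReal.ofReal_sum_of_nonneg fun k _ => h0 k]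
  · exact Finset.sum_le_sum fun k _ => hle k
  · intro k _
    have hfi : ∀ i : Fin n, AEStronglyMeasurable (fun x : Fin n → Ω => f (x i) k)
        (Measure.pi fun _ => P) := fun i =>
      ((hk k).comp_measurePreserving (measurePreserving_eval (fun _ => P) i)).aestronglyMeasurable
    exact ((((Finset.aestronglyMeasurable_fun_sum _ fun i _ => hfi i).const_mul _).sub
      aestronglyMeasurable_const).pow 2).aemeasurable.ennreal_ofReal

end Variance

/-! ### Deviations of the empirical density and of its gradient -/

variable {d n : ℕ}

theorem isProbabilityMeasure_empiricalMeasure (hn : 0 < n)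
    (x : Fin n → EuclideanSpace ℝ (Fin d)) : IsProbabilityMeasure (empiricalMeasure x) := by
  constructor
  simp only [empiricalMeasure, Measure.smul_apply, Measure.finsetSum_apply, measure_univ,
    Finset.sum_const, Finset.card_univ, Fintype.card_fin, nsmul_eq_mul, smul_eq_mul, mul_one]
  exact ENNReal.inv_mul_cancel (by exact_mod_cast hn.ne') (ENNReal.natCast_ne_top n)

theorem gradient_smoothedDensity_empiricalMeasure (hn : 0 < n)
    (x : Fin n → EuclideanSpace ℝ (Fin d)) {σ : ℝ} (hσ : 0 < σ) (z : EuclideanSpace ℝ (Fin d)) :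
    gradient (smoothedDensity (empiricalMeasure x) σ) z =
      (n : ℝ)⁻¹ • ∑ i, gaussianGradient σ (z - x i) := by
  have := isProbabilityMeasure_empiricalMeasure hn x
  rw [gradient_smoothedDensity _ hσ, empiricalMeasure, integral_smul_measure,
    integral_finsetSum_measure fun i _ => integrable_dirac (by simp)]
  simp

variable (P : Measure (EuclideanSpace ℝ (Fin d))) [IsProbabilityMeasure P]

/-- Since `φ² ≤ M φ`, the second moment is linear in the true density; this factor later cancels the
weight `1 / p`. -/
theorem lintegral_sq_smoothedDensity_sub_le (hn : 0 < n) {σ : ℝ}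
    (z : EuclideanSpace ℝ (Fin d)) :
    ∫⁻ x : Fin n → EuclideanSpace ℝ (Fin d), ENNReal.ofReal
      ((smoothedDensity (empiricalMeasure x) σ z - smoothedDensity P σ z) ^ 2)
      ∂(Measure.pi fun _ => P) ≤
      ENNReal.ofReal ((n : ℝ)⁻¹ * (gaussianPeak d σ * smoothedDensity P σ z)) := by
  have hi := integrable_gaussianDensity_sub P σ z
  have hb : ∀ y, ‖gaussianDensity σ (z - y)‖ ≤ gaussianPeak d σ := fun y => by
    rw [Real.norm_of_nonneg (gaussianDensity_nonneg σ _)]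
    exact gaussianDensity_le_peak σ _
  have hf : MemLp (fun y => gaussianDensity σ (z - y)) 2 P :=
    MemLp.of_bound hi.aestronglyMeasurable _ (.of_forall hb)
  simp_rw [smoothedDensity_empiricalMeasure]
  refine (lintegral_sq_mean_sub_integral_le P hn hf).trans (ENNReal.ofReal_le_ofReal ?_)
  gcongr
  rw [smoothedDensity, ← integral_const_mul]
  refine integral_mono hf.integrable_sq (hi.const_mul _) fun y => ?_
  simp only [sq]
  exact mul_le_mul_of_nonneg_right (gaussianDensity_le_peak σ _) (gaussianDensity_nonneg σ _)

theorem lintegral_sq_norm_gradient_smoothedDensity_sub_le (hn : 0 < n) {σ : ℝ} (hσ : 0 < σ)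
    (z : EuclideanSpace ℝ (Fin d)) :
    ∫⁻ x : Fin n → EuclideanSpace ℝ (Fin d), ENNReal.ofReal
      (‖gradient (smoothedDensity (empiricalMeasure x) σ) z - gradient (smoothedDensity P σ) z‖ ^ 2)
      ∂(Measure.pi fun _ => P) ≤
      ENNReal.ofReal ((n : ℝ)⁻¹ * (2 * gaussianPeak d σ / σ ^ 2 * smoothedDensity P σ z)) := by
  have hf : MemLp (fun y => gaussianGradient σ (z - y)) 2 P :=
    MemLp.of_bound (integrable_gaussianGradient_sub P hσ z).aestronglyMeasurable _
      (.of_forall fun y => norm_gaussianGradient_le hσ (z - y))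
  simp_rw [gradient_smoothedDensity_empiricalMeasure hn _ hσ, gradient_smoothedDensity P hσ]
  refine (lintegral_sq_norm_mean_sub_integral_le P hn hf).trans (ENNReal.ofReal_le_ofReal ?_)
  gcongr
  rw [smoothedDensity, ← integral_const_mul]
  exact integral_mono hf.norm.integrable_sq ((integrable_gaussianDensity_sub P σ z).const_mul _)
    fun y => sq_norm_gaussianGradient_le hσ (z - y)

/-! ### Pointwise bounds on the loss -/

/-- The crude bound on the integrand of the score matching loss. -/
theorem sq_norm_score_sub_mul_le {Q : Measure (EuclideanSpace ℝ (Fin d))} [IsProbabilityMeasure Q]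
    {σ ρ : ℝ} (hσ : 0 < σ) (hρ : 0 < ρ) (hL : 1 ≤ Real.log (gaussianPeak d σ / ρ))
    (z : EuclideanSpace ℝ (Fin d)) :
    ‖score P σ z - regularizedScore Q σ ρ z‖ ^ 2 * smoothedDensity P σ z ≤
      4 / σ ^ 2 * (smoothedDensity P σ z * Real.log (gaussianPeak d σ / smoothedDensity P σ z) +
        Real.log (gaussianPeak d σ / ρ) * smoothedDensity P σ z) := by
  have hp := smoothedDensity_pos P hσ z
  have h1 := sq_norm_score_le P hσ z
  have h2 := sq_norm_regularizedScore_le Q hσ hρ hL z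
  have h3 : ‖score P σ z - regularizedScore Q σ ρ z‖ ^ 2 ≤
      2 * (‖score P σ z‖ ^ 2 + ‖regularizedScore Q σ ρ z‖ ^ 2) := by
    have := norm_sub_le (score P σ z) (regularizedScore Q σ ρ z)
    calc _ ≤ (‖score P σ z‖ + ‖regularizedScore Q σ ρ z‖) ^ 2 := by gcongr
      _ ≤ _ := add_sq_le
  calc _ ≤ 2 * (2 / σ ^ 2 * Real.log (gaussianPeak d σ / smoothedDensity P σ z) +
        2 / σ ^ 2 * Real.log (gaussianPeak d σ / ρ)) * smoothedDensity P σ z := by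
        gcongr
        linarith
    _ = _ := by ring

/-- Where the true density is at least `ρ`, the loss is controlled by the deviations of the
empirical density and of its gradient. -/
theorem sq_norm_score_sub_mul_le_deviation {Q : Measure (EuclideanSpace ℝ (Fin d))}
    [IsProbabilityMeasure Q] {σ ρ : ℝ} (hσ : 0 < σ) (hρ : 0 < ρ)
    (hL : 1 ≤ Real.log (gaussianPeak d σ / ρ)) {z : EuclideanSpace ℝ (Fin d)}
    (hz : ρ ≤ smoothedDensity P σ z) :
    ‖score P σ z - regularizedScore Q σ ρ z‖ ^ 2 * smoothedDensity P σ z ≤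
      2 / smoothedDensity P σ z *
        ‖gradient (smoothedDensity Q σ) z - gradient (smoothedDensity P σ) z‖ ^ 2 +
      4 / σ ^ 2 * Real.log (gaussianPeak d σ / ρ) / smoothedDensity P σ z *
        (smoothedDensity Q σ z - smoothedDensity P σ z) ^ 2 := by
  have hp := smoothedDensity_pos P hσ z
  have h2 := sq_norm_regularizedScore_le Q hσ hρ hL z
  set r := regularizedScore Q σ ρ z with hr
  set p := smoothedDensity P σ z
  set q := smoothedDensity Q σ z
  set g := gradient (smoothedDensity P σ) z
  set g' := gradient (smoothedDensity Q σ) z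
  set L := Real.log (gaussianPeak d σ / ρ)
  have hm : 0 < max q ρ := lt_max_of_lt_right hρ
  have hg' : g' = max q ρ • r := by
    rw [hr, regularizedScore, smul_smul, mul_inv_cancel₀ hm.ne', one_smul]
  -- Writing the empirical gradient as `(q ∨ ρ) r` confines division by the empirical density to the
  -- already bounded vector `r`.
  have e : score P σ z - r = p⁻¹ • ((g - g') + (max q ρ - p) • r) := by
    rw [hg', score, sub_smul, sub_add_sub_cancel, smul_sub, inv_smul_smul₀ hp.ne']
  -- Because `ρ ≤ p`, truncating `q` from below at `ρ` cannot increase its distance to `p`.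
  have hd : (max q ρ - p) ^ 2 ≤ (q - p) ^ 2 := by
    rw [sq_le_sq]
    rcases le_total ρ q with h | h
    · rw [max_eq_left h]
    · rw [max_eq_right h, abs_of_nonpos (by linarith), abs_of_nonpos (by linarith)]
      linarith
  have h3 : ‖(g - g') + (max q ρ - p) • r‖ ^ 2 ≤
      2 * (‖g' - g‖ ^ 2 + (q - p) ^ 2 * (2 / σ ^ 2 * L)) := by
    calc _ ≤ (‖g - g'‖ + ‖(max q ρ - p) • r‖) ^ 2 := by gcongr; exact norm_add_le _ _
      _ ≤ 2 * (‖g - g'‖ ^ 2 + ‖(max q ρ - p) • r‖ ^ 2) := add_sq_le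
      _ = 2 * (‖g' - g‖ ^ 2 + (max q ρ - p) ^ 2 * ‖r‖ ^ 2) := by
          rw [norm_sub_rev, norm_smul, mul_pow, Real.norm_eq_abs, sq_abs]
      _ ≤ _ := by gcongr
  rw [e, norm_smul, mul_pow, norm_inv, Real.norm_of_nonneg hp.le]
  calc _ ≤ p⁻¹ ^ 2 * (2 * (‖g' - g‖ ^ 2 + (q - p) ^ 2 * (2 / σ ^ 2 * L))) * p := by gcongr
    _ = _ := by field_simp; ring

/-- The expected loss at a point. -/
noncomputable def pointwiseLoss (n : ℕ) (σ ρ : ℝ) (z : EuclideanSpace ℝ (Fin d)) : ℝ≥0∞ :=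
  ∫⁻ x : Fin n → EuclideanSpace ℝ (Fin d), ENNReal.ofReal
    (‖score P σ z - regularizedScore (empiricalMeasure x) σ ρ z‖ ^ 2 * smoothedDensity P σ z)
    ∂(Measure.pi fun _ => P)

theorem pointwiseLoss_le_crude (hn : 0 < n) {σ ρ : ℝ} (hσ : 0 < σ) (hρ : 0 < ρ)
    (hL : 1 ≤ Real.log (gaussianPeak d σ / ρ)) (z : EuclideanSpace ℝ (Fin d)) :
    pointwiseLoss P n σ ρ z ≤ ENNReal.ofReal
      (4 / σ ^ 2 * (smoothedDensity P σ z * Real.log (gaussianPeak d σ / smoothedDensity P σ z) +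
        Real.log (gaussianPeak d σ / ρ) * smoothedDensity P σ z)) := by
  refine (lintegral_mono fun x => ENNReal.ofReal_le_ofReal ?_).trans (by
    rw [lintegral_const, measure_univ, mul_one])
  have := isProbabilityMeasure_empiricalMeasure hn x
  exact sq_norm_score_sub_mul_le P hσ hρ hL z

theorem measurable_smoothedDensity_empiricalMeasure (σ : ℝ) :
    Measurable fun w : (Fin n → EuclideanSpace ℝ (Fin d)) × EuclideanSpace ℝ (Fin d) =>
      smoothedDensity (empiricalMeasure w.1) σ w.2 := by
  have := continuous_gaussianDensity (d := d) σ
  simp_rw [smoothedDensity_empiricalMeasure]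
  exact Continuous.measurable (by fun_prop)

theorem measurable_gradient_smoothedDensity_empiricalMeasure (hn : 0 < n) {σ : ℝ} (hσ : 0 < σ) :
    Measurable fun w : (Fin n → EuclideanSpace ℝ (Fin d)) × EuclideanSpace ℝ (Fin d) =>
      gradient (smoothedDensity (empiricalMeasure w.1) σ) w.2 := by
  have := continuous_gaussianGradient (d := d) σ
  simp_rw [gradient_smoothedDensity_empiricalMeasure hn _ hσ]
  exact Continuous.measurable (by fun_prop)

theorem expectedLoss_eq_lintegral_pointwiseLoss (hn : 0 < n) {σ ρ : ℝ} (hσ : 0 < σ) :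
    expectedLoss P n σ ρ = ∫⁻ z, pointwiseLoss P n σ ρ z := by
  refine lintegral_lintegral_swap (Measurable.aemeasurable ?_)
  have h1 : Measurable fun w : (Fin n → EuclideanSpace ℝ (Fin d)) × EuclideanSpace ℝ (Fin d) =>
      smoothedDensity P σ w.2 :=
    (continuous_smoothedDensity P σ).measurable.comp measurable_snd
  have h2 : Measurable fun w : (Fin n → EuclideanSpace ℝ (Fin d)) × EuclideanSpace ℝ (Fin d) =>
      gradient (smoothedDensity P σ) w.2 :=
    (continuous_gradient_smoothedDensity P hσ).measurable.comp measurable_snd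
  have h3 := measurable_smoothedDensity_empiricalMeasure (d := d) (n := n) σ
  have h4 := measurable_gradient_smoothedDensity_empiricalMeasure (d := d) hn hσ
  exact ((((h1.inv.smul h2).sub ((h3.max measurable_const).inv.smul h4)).norm.pow_const 2).mul
    h1).ennreal_ofReal

theorem pointwiseLoss_le_of_le (hn : 0 < n) {σ ρ : ℝ} (hσ : 0 < σ) (hρ : 0 < ρ)
    (hL : 1 ≤ Real.log (gaussianPeak d σ / ρ)) {z : EuclideanSpace ℝ (Fin d)}
    (hz : ρ ≤ smoothedDensity P σ z) :
    pointwiseLoss P n σ ρ z ≤ ENNReal.ofReal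
      (8 / σ ^ 2 * Real.log (gaussianPeak d σ / ρ) * (gaussianPeak d σ / n)) := by
  have hp := smoothedDensity_pos P hσ z
  have hM := gaussianPeak_pos (d := d) hσ
  have hn' : (0 : ℝ) < n := by exact_mod_cast hn
  have hg := lintegral_sq_norm_gradient_smoothedDensity_sub_le P hn hσ z
  have hq := lintegral_sq_smoothedDensity_sub_le P hn (σ := σ) z
  set L := Real.log (gaussianPeak d σ / ρ)
  set M := gaussianPeak d σ
  have hL0 : 0 < L := by linarith
  have hmeas : Measurable fun x : Fin n → EuclideanSpace ℝ (Fin d) => ENNReal.ofReal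
      (‖gradient (smoothedDensity (empiricalMeasure x) σ) z -
        gradient (smoothedDensity P σ) z‖ ^ 2) :=
    (((measurable_gradient_smoothedDensity_empiricalMeasure hn hσ).comp
      (measurable_id.prodMk measurable_const)).sub_const _).norm.pow_const 2 |>.ennreal_ofReal
  calc pointwiseLoss P n σ ρ z
      ≤ ∫⁻ x : Fin n → EuclideanSpace ℝ (Fin d),
        (ENNReal.ofReal (2 / smoothedDensity P σ z) * ENNReal.ofReal
          (‖gradient (smoothedDensity (empiricalMeasure x) σ) z -
            gradient (smoothedDensity P σ) z‖ ^ 2) +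
        ENNReal.ofReal (4 / σ ^ 2 * L / smoothedDensity P σ z) * ENNReal.ofReal
          ((smoothedDensity (empiricalMeasure x) σ z - smoothedDensity P σ z) ^ 2))
        ∂(Measure.pi fun _ => P) := by
        refine lintegral_mono fun x => ?_
        have := isProbabilityMeasure_empiricalMeasure hn x
        rw [← ENNReal.ofReal_mul (by positivity), ← ENNReal.ofReal_mul (by positivity),
          ← ENNReal.ofReal_add (by positivity) (by positivity)]
        exact ENNReal.ofReal_le_ofReal (sq_norm_score_sub_mul_le_deviation P hσ hρ hL hz)
    _ ≤ ENNReal.ofReal (2 / smoothedDensity P σ z) *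
          ENNReal.ofReal ((n : ℝ)⁻¹ * (2 * M / σ ^ 2 * smoothedDensity P σ z)) +
        ENNReal.ofReal (4 / σ ^ 2 * L / smoothedDensity P σ z) *
          ENNReal.ofReal ((n : ℝ)⁻¹ * (M * smoothedDensity P σ z)) := by
        rw [lintegral_add_left (hmeas.const_mul _), lintegral_const_mul' _ _ ENNReal.ofReal_ne_top,
          lintegral_const_mul' _ _ ENNReal.ofReal_ne_top]
        gcongr
    _ = ENNReal.ofReal (4 / σ ^ 2 * (1 + L) * (M / n)) := by
        rw [← ENNReal.ofReal_mul (by positivity), ← ENNReal.ofReal_mul (by positivity),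
          ← ENNReal.ofReal_add (by positivity) (by positivity)]
        congr 1
        field_simp
        ring
    _ ≤ _ := by
        refine ENNReal.ofReal_le_ofReal ?_
        have : 4 / σ ^ 2 * (1 + L) ≤ 4 / σ ^ 2 * (2 * L) := by gcongr; linarith
        calc _ ≤ 4 / σ ^ 2 * (2 * L) * (M / n) := by gcongr
          _ = _ := by ring

/-- Where `p ≤ ρ` no concentration is needed: `p log (M / p)` and `L p` are both at most `ρ L`, and
`ρ ≤ M / n`. -/
theorem pointwiseLoss_le (hn : 0 < n) {σ ρ : ℝ} (hσ : 0 < σ) (hρ : 0 < ρ)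
    (hL : 1 ≤ Real.log (gaussianPeak d σ / ρ)) (hρn : ρ ≤ gaussianPeak d σ / n)
    (z : EuclideanSpace ℝ (Fin d)) :
    pointwiseLoss P n σ ρ z ≤ ENNReal.ofReal
      (8 / σ ^ 2 * Real.log (gaussianPeak d σ / ρ) * (gaussianPeak d σ / n)) := by
  rcases le_total ρ (smoothedDensity P σ z) with hz | hz
  · exact pointwiseLoss_le_of_le P hn hσ hρ hL hz
  refine (pointwiseLoss_le_crude P hn hσ hρ hL z).trans (ENNReal.ofReal_le_ofReal ?_)
  have h := mul_log_div_le (gaussianPeak_pos (d := d) hσ) (smoothedDensity_pos P hσ z) hz hL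
  set L := Real.log (gaussianPeak d σ / ρ)
  calc _ ≤ 4 / σ ^ 2 * (ρ * L + L * ρ) := by gcongr
    _ = 8 / σ ^ 2 * L * ρ := by ring
    _ ≤ _ := by gcongr

theorem pointwiseLoss_le_tail (hn : 0 < n) {α σ ρ : ℝ} (hP : IsSubGaussian P α) (hσ : 0 < σ)
    (hρ : 0 < ρ) (hL : 1 ≤ Real.log (gaussianPeak d σ / ρ)) (hlog : 1 ≤ Real.log n)
    {z : EuclideanSpace ℝ (Fin d)} {w : ℝ}
    (hw : w = ‖z - ∫ y, y ∂P‖ ^ 2 / (2 * (σ ^ 2 + α ^ 2))) (htail : 2 * Real.log n ≤ w) :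
    pointwiseLoss P n σ ρ z ≤ ENNReal.ofReal
      (20 / σ ^ 2 * Real.log (gaussianPeak d σ / ρ) * (gaussianPeak d σ / n) *
        Real.exp (-(w / 4))) := by
  have hM := gaussianPeak_pos (d := d) hσ
  have hn' : (0 : ℝ) < n := by exact_mod_cast hn
  refine (pointwiseLoss_le_crude P hn hσ hρ hL z).trans (ENNReal.ofReal_le_ofReal ?_)
  have hp := smoothedDensity_le_of_isSubGaussian hP hσ z
  rw [← hw] at hp
  have hlogM : Real.log (gaussianPeak d σ / (gaussianPeak d σ * Real.exp (-w))) = w := by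
    rw [← div_div, div_self hM.ne', one_div, Real.log_inv, Real.log_exp, neg_neg]
  have h := mul_log_div_le hM (smoothedDensity_pos P hσ z) hp (by rw [hlogM]; linarith)
  rw [hlogM] at h
  set L := Real.log (gaussianPeak d σ / ρ)
  set M := gaussianPeak d σ
  -- The factor `exp (-w)` is split as `1/2 + 1/4 + 1/4` in the exponent: the half pays for `1 / n`,
  -- one quarter absorbs the factor `w`, the other survives as decay. The constant is `20 = 4 · (4 +
  -- 1)`.
  have e1 : Real.exp (-(w / 2)) ≤ (n : ℝ)⁻¹ := by
    rw [← Real.exp_log hn', ← Real.exp_neg]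
    exact Real.exp_le_exp.2 (by linarith)
  have e2 : w * Real.exp (-(w / 4)) ≤ 4 := by
    have := Real.add_one_le_exp (w / 4)
    rw [Real.exp_neg, ← div_eq_mul_inv, div_le_iff₀ (Real.exp_pos _)]
    linarith
  have e3 : Real.exp (-w) = Real.exp (-(w / 2)) * Real.exp (-(w / 4)) * Real.exp (-(w / 4)) := by
    rw [← Real.exp_add, ← Real.exp_add]; congr 1; ring
  have e4 : Real.exp (-(w / 4)) ≤ 1 := Real.exp_le_one_iff.2 (by linarith)
  have e5 : w * Real.exp (-w) ≤ 4 * ((n : ℝ)⁻¹ * Real.exp (-(w / 4))) := by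
    calc _ = (w * Real.exp (-(w / 4))) * (Real.exp (-(w / 2)) * Real.exp (-(w / 4))) := by
          rw [e3]; ring
      _ ≤ 4 * ((n : ℝ)⁻¹ * Real.exp (-(w / 4))) := by gcongr
  have e6 : Real.exp (-w) ≤ (n : ℝ)⁻¹ * Real.exp (-(w / 4)) := by
    rw [e3]
    exact mul_le_of_le_one_right (by positivity) e4 |>.trans (by gcongr)
  have e7 : 4 ≤ 4 * L := by linarith
  calc _ ≤ 4 / σ ^ 2 * (M * Real.exp (-w) * w + L * (M * Real.exp (-w))) := by gcongr
    _ = 4 / σ ^ 2 * M * (w * Real.exp (-w) + L * Real.exp (-w)) := by ring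
    _ ≤ 4 / σ ^ 2 * M * (4 * L * ((n : ℝ)⁻¹ * Real.exp (-(w / 4))) +
          L * ((n : ℝ)⁻¹ * Real.exp (-(w / 4)))) := by
        have e8 : 4 * ((n : ℝ)⁻¹ * Real.exp (-(w / 4))) ≤
            4 * L * ((n : ℝ)⁻¹ * Real.exp (-(w / 4))) := by gcongr
        exact mul_le_mul_of_nonneg_left (add_le_add (e5.trans e8) (by gcongr)) (by positivity)
    _ = _ := by field_simp; ring

/-- The profile is `exp (-w / (4 log n))`. For `w ≤ 2 log n` it is at least `1/2`, so the uniform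
bound fits since `8 ≤ 20 / 2`; for larger `w` it dominates `exp (-w / 4)` because `log n ≥ 1`. -/
theorem pointwiseLoss_le_gaussian (hn : 0 < n) {α σ ρ : ℝ} (hP : IsSubGaussian P α) (hσ : 0 < σ)
    (hρ : 0 < ρ) (hL : 1 ≤ Real.log (gaussianPeak d σ / ρ)) (hρn : ρ ≤ gaussianPeak d σ / n)
    (hlog : 1 ≤ Real.log n) (z : EuclideanSpace ℝ (Fin d)) :
    pointwiseLoss P n σ ρ z ≤ ENNReal.ofReal
      (20 / σ ^ 2 * Real.log (gaussianPeak d σ / ρ) * (gaussianPeak d σ / n) *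
        Real.exp (-(8 * (σ ^ 2 + α ^ 2) * Real.log n)⁻¹ * ‖z - ∫ y, y ∂P‖ ^ 2)) := by
  have hM := gaussianPeak_pos (d := d) hσ
  have hn' : (0 : ℝ) < n := by exact_mod_cast hn
  have hl0 : 0 < Real.log n := by linarith
  set w := ‖z - ∫ y, y ∂P‖ ^ 2 / (2 * (σ ^ 2 + α ^ 2)) with hw
  have hw0 : 0 ≤ w := by positivity
  have e : -(8 * (σ ^ 2 + α ^ 2) * Real.log n)⁻¹ * ‖z - ∫ y, y ∂P‖ ^ 2 =
      -(w / 4 / Real.log n) := by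
    rw [hw]; field_simp; ring
  rw [e]
  rcases le_total (2 * Real.log n) w with ht | ht
  · refine (pointwiseLoss_le_tail P hn hP hσ hρ hL hlog hw ht).trans
      (ENNReal.ofReal_le_ofReal ?_)
    have : w / 4 / Real.log n ≤ w / 4 := div_le_self (by positivity) hlog
    gcongr
  · refine (pointwiseLoss_le P hn hσ hρ hL hρn z).trans (ENNReal.ofReal_le_ofReal ?_)
    have h1 : (1 : ℝ) / 2 ≤ Real.exp (-(w / 4 / Real.log n)) := by
      have h2 : w / 4 / Real.log n ≤ 1 / 2 := by
        rw [div_le_iff₀ hl0]; linarith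
      have := Real.add_one_le_exp (-(w / 4 / Real.log n))
      linarith
    set L := Real.log (gaussianPeak d σ / ρ)
    calc _ ≤ 20 / σ ^ 2 * L * (gaussianPeak d σ / n) * (1 / 2) := by
          have : 0 ≤ σ⁻¹ ^ 2 * L * (gaussianPeak d σ / n) := by positivity
          rw [div_eq_mul_inv, div_eq_mul_inv 20, ← inv_pow]
          linarith
      _ ≤ _ := by gcongr

/-! ### Integrating the profile -/

theorem lintegral_gaussian_profile {b : ℝ} (hb : 0 < b) (m : EuclideanSpace ℝ (Fin d)) {K : ℝ}
    (hK : 0 ≤ K) :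
    ∫⁻ z, ENNReal.ofReal (K * Real.exp (-b * ‖z - m‖ ^ 2)) =
      ENNReal.ofReal (K * (Real.pi / b) ^ ((d : ℝ) / 2)) := by
  have h0 := GaussianFourier.integral_rexp_neg_mul_sq_norm (V := EuclideanSpace ℝ (Fin d)) hb
  rw [finrank_euclideanSpace_fin] at h0
  -- The Bochner integral of a non-integrable function is `0`, so a nonzero value proves
  -- integrability.
  have hi : Integrable fun v : EuclideanSpace ℝ (Fin d) => Real.exp (-b * ‖v‖ ^ 2) :=
    Integrable.of_integral_ne_zero (by rw [h0]; positivity)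
  rw [lintegral_sub_right_eq_self (fun z => ENNReal.ofReal (K * Real.exp (-b * ‖z‖ ^ 2))) m,
    ← ofReal_integral_eq_lintegral_ofReal (hi.const_mul K) (.of_forall fun z => by positivity),
    integral_const_mul, h0]

theorem gaussianPeak_mul_rpow_le {α σ l : ℝ} (hα : 0 < α) (hσ : 0 < σ) (hl : 0 < l) :
    gaussianPeak d σ * (Real.pi / (8 * (σ ^ 2 + α ^ 2) * l)⁻¹) ^ ((d : ℝ) / 2) ≤
      4 ^ d * (σ ^ (-(d : ℝ)) * (σ ^ d + α ^ d) * l ^ ((d : ℝ) / 2)) := by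
  have hpi := Real.pi_pos
  -- The factor `2πσ²` is isolated because its power `d / 2` cancels the peak.
  have e1 : Real.pi / (8 * (σ ^ 2 + α ^ 2) * l)⁻¹ =
      (2 * Real.pi * σ ^ 2) * ((4 * (σ ^ 2 + α ^ 2)) * (l * (σ ^ 2)⁻¹)) := by
    field_simp; norm_num
  have e2 : gaussianPeak d σ * (2 * Real.pi * σ ^ 2) ^ ((d : ℝ) / 2) = 1 := by
    rw [gaussianPeak, ← Real.rpow_add (by positivity)]
    simp [neg_div]
  have e3 : ((σ ^ 2)⁻¹ : ℝ) ^ ((d : ℝ) / 2) = σ ^ (-(d : ℝ)) := by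
    rw [← Real.rpow_natCast, ← Real.rpow_neg hσ.le, ← Real.rpow_mul hσ.le]
    congr 1
    push_cast
    ring
  have e4 : (4 * (σ ^ 2 + α ^ 2)) ^ ((d : ℝ) / 2) ≤ 4 ^ d * (σ ^ d + α ^ d) := by
    -- The left side is at most `8 (max σ α)²`; rounding `8` up to `4²` gives the clean constant `4
    -- ^ d`.
    have h1 : 4 * (σ ^ 2 + α ^ 2) ≤ (4 * max σ α) ^ 2 := by
      rcases le_total σ α with h | h
      · rw [max_eq_right h]; nlinarith
      · rw [max_eq_left h]; nlinarith
    calc (4 * (σ ^ 2 + α ^ 2)) ^ ((d : ℝ) / 2) ≤ ((4 * max σ α) ^ 2) ^ ((d : ℝ) / 2) := by gcongr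
      _ = (4 * max σ α) ^ d := by
          have : 0 ≤ 4 * max σ α := by positivity
          rw [← Real.rpow_natCast, ← Real.rpow_mul this, ← Real.rpow_natCast]
          congr 1
          push_cast
          ring
      _ = 4 ^ d * max σ α ^ d := mul_pow _ _ _
      _ ≤ 4 ^ d * (σ ^ d + α ^ d) := by
          gcongr
          rcases le_total σ α with h | h
          · rw [max_eq_right h]; linarith [pow_pos hσ d]
          · rw [max_eq_left h]; linarith [pow_pos hα d]
  rw [e1, Real.mul_rpow (x := 2 * Real.pi * σ ^ 2) (by positivity) (by positivity), ← mul_assoc,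
    e2, one_mul,
    Real.mul_rpow (x := 4 * (σ ^ 2 + α ^ 2)) (by positivity) (by positivity),
    Real.mul_rpow (x := l) (by positivity) (by positivity), e3]
  calc _ ≤ 4 ^ d * (σ ^ d + α ^ d) * (l ^ ((d : ℝ) / 2) * σ ^ (-(d : ℝ))) := by gcongr
    _ = _ := by ring

end SubGaussianScore

/-! ### Assembly of the final bound -/

theorem mainTheorem1 (d : ℕ) (hd : 1 ≤ d) (c : ℝ) (hc : 0 < c) :
    ∃ C : ℝ, 0 < C ∧
      ∀ (n : ℕ), 3 ≤ n →
      ∀ (P : Measure (EuclideanSpace ℝ (Fin d))) [IsProbabilityMeasure P] (α σ ρ : ℝ),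
        SubGaussianScore.IsSubGaussian P α →
        c * α * (n : ℝ) ^ (-(1 : ℝ) / d) * Real.log n ^ ((1 : ℝ) / 2) ≤ σ →
        0 < ρ →
        ρ ≤ (2 * Real.pi * σ ^ 2) ^ (-(d : ℝ) / 2) * Real.exp (-1) * (n : ℝ)⁻¹ →
        SubGaussianScore.expectedLoss P n σ ρ ≤
          ENNReal.ofReal
            (C * (σ ^ (-(d : ℝ) - 2) * (σ ^ d + α ^ d) *
              Real.log ((2 * Real.pi * σ ^ 2) ^ (-(d : ℝ) / 2) / ρ) ^ 3 *
              (Real.log n ^ ((d : ℝ) / 2) / n))) := by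
  -- `20` comes from the pointwise profile and `4 ^ d` from its integral.
  refine ⟨20 * 4 ^ d, by positivity, fun n hn P _ α σ ρ hP hσc hρ hρn => ?_⟩
  have hα := hP.pos
  have hn3 : (3 : ℝ) ≤ n := by exact_mod_cast hn
  have hn' : (0 : ℝ) < n := by linarith
  -- This is where `n ≥ 3 > e` matters.
  have hlog : 1 ≤ Real.log n := by
    rw [Real.le_log_iff_exp_le hn']
    linarith [Real.exp_one_lt_d9]
  have hσ : 0 < σ := lt_of_lt_of_le (by
    have : 0 < Real.log n := by linarith
    positivity) hσc
  have hM := SubGaussianScore.gaussianPeak_pos (d := d) hσ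
  change ρ ≤ SubGaussianScore.gaussianPeak d σ * Real.exp (-1) * (n : ℝ)⁻¹ at hρn
  change _ ≤ ENNReal.ofReal (20 * 4 ^ d * (_ * _ *
    Real.log (SubGaussianScore.gaussianPeak d σ / ρ) ^ 3 * _))
  set M := SubGaussianScore.gaussianPeak d σ with hMdef
  have hL : 1 ≤ Real.log (M / ρ) := by
    rw [Real.le_log_iff_exp_le (by positivity), le_div_iff₀ hρ]
    calc Real.exp 1 * ρ ≤ Real.exp 1 * (M * Real.exp (-1) * (n : ℝ)⁻¹) := by gcongr
      _ = M * (n : ℝ)⁻¹ := by rw [Real.exp_neg]; field_simp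
      _ ≤ M := mul_le_of_le_one_right hM.le (inv_le_one_of_one_le₀ (by linarith))
  have hρn' : ρ ≤ M / n := hρn.trans (by
    rw [div_eq_mul_inv]
    gcongr
    exact mul_le_of_le_one_right hM.le (Real.exp_le_one_iff.2 (by norm_num)))
  rw [SubGaussianScore.expectedLoss_eq_lintegral_pointwiseLoss P (by omega) hσ]
  refine (lintegral_mono (SubGaussianScore.pointwiseLoss_le_gaussian P (by omega) hP hσ hρ hL
    hρn' hlog)).trans ?_
  rw [SubGaussianScore.lintegral_gaussian_profile (by positivity) _ (by positivity)]
  refine ENNReal.ofReal_le_ofReal ?_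
  have h := SubGaussianScore.gaussianPeak_mul_rpow_le (d := d) hα hσ (l := Real.log n)
    (by linarith)
  rw [← hMdef] at h
  set L := Real.log (M / ρ)
  set G := (Real.pi / (8 * (σ ^ 2 + α ^ 2) * Real.log n)⁻¹) ^ ((d : ℝ) / 2)
  -- The argument gives the first power of `L`; the cube follows from `L ≥ 1`.
  have hL3 : L ≤ L ^ 3 := le_self_pow₀ hL (by norm_num)
  have hs : σ ^ (-(d : ℝ) - 2) = σ ^ (-(d : ℝ)) / σ ^ 2 := by
    rw [Real.rpow_sub hσ, Real.rpow_two]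
  calc _ = 20 / σ ^ 2 * L / n * (M * G) := by ring
    _ ≤ 20 / σ ^ 2 * L ^ 3 / n *
        (4 ^ d * (σ ^ (-(d : ℝ)) * (σ ^ d + α ^ d) * Real.log n ^ ((d : ℝ) / 2))) := by gcongr
    _ = _ := by rw [hs]; ring
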